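/- **Setting.** Let $i_1,i_2,\dots$ be Grassmann generators ($i_ki_l=-i_li_k$, $i_k^2=0$). For a finite set $\alpha=\{a_1<\dots<a_t\}$ of positive integers put $i_\alpha=i_{a_1}\cdots i_{a_t}$ and $i_\emptyset=1$. Let $\varphi:\{0,1,2,\dots\}\to\mathbb R$ be nondecreasing with $\varphi(0)=0$, let $c_\alpha=e^{\varphi(a_1)+\dots+\varphi(a_t)}$, and assume $\sum_\alpha c_\alpha^{-2d}<\infty$ for some positive integer $d$. For $p\in\mathbb Z$ let $\mathcal H_p$ be the Hilbert space of all formal series $f=\sum_\alpha f_\alpha i_\alpha$, $f_\alpha\in\mathbb C$, with $\|f\|_{\mathcal H_p}^2=\sum_\alpha|f_\alpha|^2c_\alpha^{2p}<\infty$. Let $\mathfrak S_1=\bigcap_p\mathcal H_p$, with the Fréchet topology of all these norms, and $\mathfrak S_{-1}=\bigcup_p\mathcal H_{-p}$, with the strong topology as its dual, that is, uniform convergence on bounded subsets of $\mathfrak S_1$ under the pairing $\langle f,g\rangle=\sum_\alpha f_\alpha\overline{g_\alpha}$. For $f\in\mathfrak S_{-1}$ let $T_f=M_f+M_f^*$ on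 $\mathfrak S_1$, where $M_fg=fg$ is the Grassmann product and $M_f^*$ is its adjoint, $\langle M_f^*g,i_\gamma\rangle=\langle g,f\,i_\gamma\rangle$ for all $\gamma$. Let $m:\mathbb R\to[0,\infty)$ be measurable with $$m(u)\le K|u|^{-b}\ \ (0<|u|\le1),\qquad m(u)\le K|u|^{2N}\ \ (|u|>1),\qquad \int_{\mathbb R}\frac{m(u)}{u^2+1}\,du<\infty,$$ where $b<2$, $N\in\{0,1,2,\dots\}$ and $K>0$. Let $S_m$ be the operator in $L^2(\mathbb R)$ with $\widehat{S_mf}=\sqrt m\,\widehat f$ and domain $\{f\in L^2(\mathbb R):\int m|\widehat f|^2<\infty\}$, where $\widehat f(u)=\int e^{-iux}f(x)\,dx$. Let $\xi_n$, $n\ge1$, be the normalized Hermite functions, $\xi_n(x)=(\sqrt\pi\,2^{n-1}(n-1)!)^{-1/2}H_{n-1}(x)e^{-x^2/2}$, with $H_k$ the physicists' Hermite polynomials. **Theorem.** Every $\xi_n$ lies in the domain of $S_m$. For every $t\in\mathbb R$ the series $$f_m(t)=\sum_{n\ge1}\Big(\int_0^t(S_m\xi_n)(x)\,dx\Big)i_n$$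 belongs to $\mathfrak S_{-1}$, and $X_m(t)=T_{f_m(t)}$ is a well-defined continuous linear operator from $\mathfrak S_1$ into $\mathfrak S_{-1}$ (the series giving the coefficients of $M_{f_m(t)}^*g$ converge absolutely). For every $g\in\mathfrak S_1$ the map $t\mapsto X_m(t)g$ is continuous from $\mathbb R$ into $\mathfrak S_{-1}$. Moreover there are continuous linear operators $W_m(t):\mathfrak S_1\to\mathfrak S_{-1}$, $t\in\mathbb R$, such that for every $g\in\mathfrak S_1$ and every $t\in\mathbb R$ $$\frac{d}{dt}X_m(t)g=W_m(t)g\quad\text{in the strong topology of }\mathfrak S_{-1},$$ and for every $g\in\mathfrak S_1$ the map $t\mapsto W_m(t)g$ is continuous from $\mathbb R$ into $\mathfrak S_{-1}$. -/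

import Mathlib

open scoped FourierTransform Topology ComplexConjugate
open MeasureTheory

noncomputable section

namespace GrassmannProcess

/-! ### Formal Grassmann series

The generators are `i_1, i_2, …`.  A finite set `α : Finset ℕ` stands for the increasing multi-index
`(a_1 + 1, …, a_t + 1)` with `α = {a_1 < ⋯ < a_t}`: the natural number `k` is the position of the
generator `i_{k+1}`, and `∅` is the index of the unit `i_0 = 1`.  A function `f : Finset ℕ → ℂ`
is the formal series `∑ f_α i_α`. -/

/-- Formal Grassmann series `∑ f_α i_α`. -/
abbrev Series : Type := Finset ℕ → ℂ

/-- The basis series `i_α`. -/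
def basisSeries (α : Finset ℕ) : Series := fun β => if β = α then 1 else 0

/-- The series `∑ a_k i_{k+1}` of degree one. -/
def linearSeries (a : ℕ → ℂ) : Series :=
  fun α => ∑ k ∈ α, if α = {k} then a k else 0

/-- The sign in `i_α i_β = ± i_{α ∪ β}` for disjoint `α`, `β`: the parity of the number of
transpositions that sort the concatenation, i.e. of the pairs `(a, b)` with `b < a`. -/
def grassmannSign (α β : Finset ℕ) : ℂ :=
  (-1) ^ ((α ×ˢ β).filter fun q => q.2 < q.1).card

/-- The Grassmann product `f g`: its coefficient at `γ` is the finite sum over all splittings of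
`γ` into disjoint `α` and `γ \ α`. -/
def grassmannMul (f g : Series) : Series :=
  fun γ => ∑ α ∈ γ.powerset, grassmannSign α (γ \ α) * f α * g (γ \ α)

/-- The pairing `⟨z, w⟩ = ∑ z_α conj (w_α)`. -/
def pairing (z w : Series) : ℂ := ∑' α, z α * conj (w α)

/-- The adjoint `M_f^*` of left multiplication by `f`, through its coefficients
`⟨M_f^* g, i_γ⟩ = ⟨g, f i_γ⟩`. -/
def adjointMul (f g : Series) : Series :=
  fun γ => pairing g (grassmannMul f (basisSeries γ))

/-- The operator `T_f = M_f + M_f^*`. -/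
def opT (f g : Series) : Series := grassmannMul f g + adjointMul f g

/-! ### The scale of weighted spaces and the Gelfand triple -/

/-- The weights `c_α = exp (φ(a_1) + ⋯ + φ(a_t))`, where the generators in `α` are
`i_{a_1}, …, i_{a_t}` (numbered from `1`). -/
def weight (φ : ℕ → ℝ) (α : Finset ℕ) : ℝ := Real.exp (∑ k ∈ α, φ (k + 1))

lemma weight_pos (φ : ℕ → ℝ) (α : Finset ℕ) : 0 < weight φ α := Real.exp_pos _

/-- The Hilbert space `H_p` of all series with `∑ |f_α|² c_α^{2p} < ∞`, for `p ∈ ℤ`. -/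
def weightedSpace (φ : ℕ → ℝ) (p : ℤ) : Submodule ℂ Series where
  carrier := {f | Summable fun α => ‖f α‖ ^ 2 * weight φ α ^ (2 * p)}
  zero_mem' := by simp [summable_zero]
  add_mem' := by
    intro f g hf hg
    refine Summable.of_nonneg_of_le (fun α => ?_) (fun α => ?_)
      ((hf.mul_left 2).add (hg.mul_left 2))
    · have := weight_pos φ α
      positivity
    · have hw : 0 ≤ weight φ α ^ (2 * p) := (zpow_pos (weight_pos φ α) _).le
      have h1 : ‖(f + g) α‖ ^ 2 ≤ 2 * ‖f α‖ ^ 2 + 2 * ‖g α‖ ^ 2 := by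
        have h2 : ‖(f + g) α‖ ≤ ‖f α‖ + ‖g α‖ := norm_add_le _ _
        have h3 := norm_nonneg ((f + g) α)
        nlinarith [sq_nonneg (‖f α‖ - ‖g α‖)]
      nlinarith [mul_le_mul_of_nonneg_right h1 hw]
  smul_mem' := by
    intro a f hf
    refine (hf.mul_left (‖a‖ ^ 2)).congr fun α => ?_
    simp only [Pi.smul_apply, smul_eq_mul, norm_mul]
    ring

/-- `𝔖_1 = ⋂ H_p`, as a set of series. -/
def testSeries (φ : ℕ → ℝ) : Submodule ℂ Series := ⨅ p : ℤ, weightedSpace φ p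

/-- `𝔖_{-1} = ⋃ H_{-p}`, as a set of series.  For weights `≥ 1` the supremum of subspaces is the
union, see `mem_distSeries_iff`. -/
def distSeries (φ : ℕ → ℝ) : Submodule ℂ Series := ⨆ p : ℤ, weightedSpace φ (-p)

lemma mem_testSeries_iff {φ : ℕ → ℝ} {f : Series} :
    f ∈ testSeries φ ↔ ∀ p : ℤ, f ∈ weightedSpace φ p := by
  simp [testSeries]

lemma weightedSpace_antitone {φ : ℕ → ℝ} (h0 : φ 0 = 0) (hφ : Monotone φ) :
    Antitone (weightedSpace φ) := by
  intro p q hpq f hf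
  have h1 (α : Finset ℕ) : 1 ≤ weight φ α := by
    refine Real.one_le_exp (Finset.sum_nonneg fun k _ => ?_)
    rw [← h0]
    exact hφ (Nat.zero_le _)
  refine Summable.of_nonneg_of_le (fun α => ?_) (fun α => ?_) hf
  · have := weight_pos φ α
    positivity
  · exact mul_le_mul_of_nonneg_left (zpow_le_zpow_right₀ (h1 α) (by omega)) (by positivity)

lemma mem_distSeries_iff {φ : ℕ → ℝ} (h0 : φ 0 = 0) (hφ : Monotone φ) {f : Series} :
    f ∈ distSeries φ ↔ ∃ p : ℤ, f ∈ weightedSpace φ (-p) := by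
  refine Submodule.mem_iSup_of_directed _ (Monotone.directed_le fun p q hpq => ?_)
  exact weightedSpace_antitone h0 hφ (neg_le_neg hpq)

/-- The space `𝔖_1` of test elements. -/
def TestSpace (φ : ℕ → ℝ) : Type := testSeries φ

/-- The space `𝔖_{-1}` of distributions. -/
def DistSpace (φ : ℕ → ℝ) : Type := distSeries φ

instance (φ : ℕ → ℝ) : AddCommGroup (TestSpace φ) := inferInstanceAs (AddCommGroup (testSeries φ))
instance (φ : ℕ → ℝ) : Module ℂ (TestSpace φ) := inferInstanceAs (Module ℂ (testSeries φ))
instance (φ : ℕ → ℝ) : AddCommGroup (DistSpace φ) := inferInstanceAs (AddCommGroup (distSeries φ))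
instance (φ : ℕ → ℝ) : Module ℂ (DistSpace φ) := inferInstanceAs (Module ℂ (distSeries φ))

/-- The underlying series of a test element. -/
def TestSpace.series {φ : ℕ → ℝ} (g : TestSpace φ) : Series := Subtype.val g

/-- The underlying series of a distribution. -/
def DistSpace.series {φ : ℕ → ℝ} (f : DistSpace φ) : Series := Subtype.val f

/-- The isometric identification `f ↦ (f_α c_α^p)_α` of `H_p` with `ℓ²`, on test elements. -/
def TestSpace.toL2 {φ : ℕ → ℝ} (p : ℤ) (g : TestSpace φ) : lp (fun _ : Finset ℕ => ℂ) 2 :=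
  ⟨fun α => g.series α * (weight φ α ^ p : ℝ), by
    refine memℓp_gen ?_
    refine (mem_testSeries_iff.1 g.2 p).congr fun α => ?_
    have h : ‖((weight φ α ^ p : ℝ) : ℂ)‖ = weight φ α ^ p := by
      rw [Complex.norm_real, Real.norm_of_nonneg (zpow_pos (weight_pos φ α) _).le]
    simp only [norm_mul, h, ENNReal.toReal_ofNat, Real.rpow_two, mul_pow]
    rw [mul_comm 2 p, zpow_mul]
    norm_cast⟩

/-- The norm of `H_p` on test elements. -/
def TestSpace.normH {φ : ℕ → ℝ} (p : ℤ) (g : TestSpace φ) : ℝ := ‖g.toL2 p‖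

/-- The Fréchet topology of `𝔖_1`, generated by all the norms of the spaces `H_p`. -/
instance (φ : ℕ → ℝ) : TopologicalSpace (TestSpace φ) :=
  ⨅ p : ℤ, TopologicalSpace.induced (TestSpace.toL2 p) inferInstance

/-- Bounded sets of `𝔖_1`: those on which each of the norms is bounded. -/
def TestSpace.IsBdd {φ : ℕ → ℝ} (B : Set (TestSpace φ)) : Prop :=
  ∀ p : ℤ, ∃ C : ℝ, ∀ g ∈ B, g.normH p ≤ C

/-- A distribution as a functional on `𝔖_1`, recorded for uniform convergence on bounded sets. -/
def DistSpace.toFunctional {φ : ℕ → ℝ} (f : DistSpace φ) :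
    UniformOnFun (TestSpace φ) ℂ {B | TestSpace.IsBdd B} :=
  UniformOnFun.ofFun _ fun g => pairing f.series g.series

/-- The strong topology of `𝔖_{-1}` as the dual of `𝔖_1`: uniform convergence on the bounded sets
of `𝔖_1`. -/
instance (φ : ℕ → ℝ) : TopologicalSpace (DistSpace φ) :=
  TopologicalSpace.induced DistSpace.toFunctional inferInstance

/-! ### Hermite functions and the operator `S_m` -/

/-- The Hilbert space `L²(ℝ)` of complex functions. -/
abbrev L2R : Type := Lp ℂ 2 (volume : Measure ℝ)

/-- The normalized Hermite function
`π^{-1/4} (k!)^{-1/2} He_k(√2 x) e^{-x²/2}`, with `He_k` the probabilists' Hermite polynomial.  It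
is `(√π 2^k k!)^{-1/2} H_k(x) e^{-x²/2}` in terms of the physicists' one, and is `ξ_{k+1}` in the
numbering `ξ_1, ξ_2, …`. -/
def hermiteFun (k : ℕ) (x : ℝ) : ℝ :=
  Real.pi ^ (-(1 / 4) : ℝ) * (√(k.factorial : ℝ))⁻¹ *
    ((Polynomial.hermite k).map (Int.castRingHom ℝ)).eval (√2 * x) * Real.exp (-(x ^ 2 / 2))

lemma integrable_polynomial_mul_gaussian (q : Polynomial ℝ) :
    Integrable fun x : ℝ => q.eval x * Real.exp (-(x ^ 2)) := by
  induction q using Polynomial.induction_on' with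
  | add p q hp hq =>
    simp only [Polynomial.eval_add, add_mul]
    exact hp.add hq
  | monomial n a =>
    have h := integrable_rpow_mul_exp_neg_mul_sq (b := 1) one_pos (s := (n : ℝ))
      (by have : (0 : ℝ) ≤ n := n.cast_nonneg
          linarith)
    refine (h.const_mul a).congr (Filter.Eventually.of_forall fun x => ?_)
    simp only [Polynomial.eval_monomial, Real.rpow_natCast, neg_mul, one_mul]
    ring

lemma memLp_hermiteFun (k : ℕ) : MemLp (fun x => (hermiteFun k x : ℂ)) 2 volume := by
  have hc : Continuous fun x => (hermiteFun k x : ℂ) := by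
    unfold hermiteFun
    fun_prop
  rw [memLp_two_iff_integrable_sq_norm hc.aestronglyMeasurable]
  set q : Polynomial ℝ := ((Polynomial.hermite k).map (Int.castRingHom ℝ)).comp
    (Polynomial.C √2 * Polynomial.X)
  set a : ℝ := Real.pi ^ (-(1 / 4) : ℝ) * (√(k.factorial : ℝ))⁻¹
  refine (integrable_polynomial_mul_gaussian (Polynomial.C (a ^ 2) * q ^ 2)).congr
    (Filter.Eventually.of_forall fun x => ?_)
  have he : Real.exp (-(x ^ 2)) = Real.exp (-(x ^ 2 / 2)) ^ 2 := by
    rw [← Real.exp_nat_mul]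
    congr 1
    push_cast
    ring
  simp only [Complex.norm_real, Real.norm_eq_abs, sq_abs, he, hermiteFun, q, a,
    Polynomial.eval_mul, Polynomial.eval_C, Polynomial.eval_pow, Polynomial.eval_comp,
    Polynomial.eval_X]
  ring

/-- The Hermite functions as elements of `L²(ℝ)`. -/
def hermiteL2 (k : ℕ) : L2R := (memLp_hermiteFun k).toLp _

/-- The function `√m · f̂`.  The convention here is `f̂(u) = ∫ e^{-iux} f(x) dx`, so that
`f̂(2πv) = (𝓕 f)(v)`; the function is recorded in the variable `v = u / (2π)`. -/
def multiplied (m : ℝ → ℝ) (f : L2R) : ℝ → ℂ :=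
  fun v => (√(m (2 * Real.pi * v)) : ℂ) * (𝓕 f : L2R) v

lemma multiplied_add (m : ℝ → ℝ) (f g : L2R) :
    multiplied m f + multiplied m g =ᵐ[volume] multiplied m (f + g) := by
  have h : (𝓕 (f + g) : L2R) = 𝓕 f + 𝓕 g := FourierTransform.fourier_add f g
  filter_upwards [Lp.coeFn_add (𝓕 f : L2R) (𝓕 g : L2R)] with v hv
  simp only [multiplied, Pi.add_apply, h, hv]
  ring

lemma multiplied_smul (m : ℝ → ℝ) (a : ℂ) (f : L2R) :
    a • multiplied m f =ᵐ[volume] multiplied m (a • f) := by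
  have h : (𝓕 (a • f) : L2R) = a • 𝓕 f := FourierTransform.fourier_smul a f
  filter_upwards [Lp.coeFn_smul a (𝓕 f : L2R)] with v hv
  simp only [multiplied, Pi.smul_apply, h, hv, smul_eq_mul]
  ring

/-- The operator `S_m` in `L²(ℝ)` given by `(S_m f)^ = √m · f̂`, on the domain
`{f ∈ L²(ℝ) | ∫ m |f̂|² < ∞}`. -/
def opS (m : ℝ → ℝ) : L2R →ₗ.[ℂ] L2R where
  domain :=
    { carrier := {f | MemLp (multiplied m f) 2 volume}
      zero_mem' := by
        have h := multiplied_smul m 0 0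
        rw [zero_smul, zero_smul] at h
        exact (memLp_congr_ae h).1 MemLp.zero
      add_mem' := fun {f g} hf hg => (memLp_congr_ae (multiplied_add m f g)).1 (MemLp.add hf hg)
      smul_mem' := fun a f hf =>
        (memLp_congr_ae (multiplied_smul m a f)).1 (MemLp.const_smul hf a) }
  toFun :=
    { toFun := fun f => 𝓕⁻ (MemLp.toLp (multiplied m f) f.2 : L2R)
      map_add' := by
        intro f g
        rw [← FourierTransform.fourierInv_add, ← MemLp.toLp_add]
        congr 1
        exact (MemLp.toLp_eq_toLp_iff _ _).2 (multiplied_add m f g).symm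
      map_smul' := by
        intro a f
        rw [RingHom.id_apply, ← FourierTransform.fourierInv_smul, ← MemLp.toLp_const_smul]
        congr 1
        exact (MemLp.toLp_eq_toLp_iff _ _).2 (multiplied_smul m a f).symm }

/-- `f_m(t) = ∑ (∫_0^t S_m ξ_n) i_n`. -/
def processSeries (m : ℝ → ℝ) (hξ : ∀ k, hermiteL2 k ∈ (opS m).domain) (t : ℝ) : Series :=
  linearSeries fun k => ∫ x in (0 : ℝ)..t, (opS m ⟨hermiteL2 k, hξ k⟩ : L2R) x

end GrassmannProcess

end

open GrassmannProcess Filter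

open GrassmannProcess Filter

noncomputable section

namespace GrassmannProcess

/-! ### Weights -/

section Weights

variable {φ : ℕ → ℝ}

/-! Everything reduces to one estimate: the functions $S_m\xi_n$ have continuous representatives
whose sup norms grow at most linearly in $n$. By AM-GM, $|\sqrt m\,\hat\xi_n| \le
\frac12\big(\frac{m}{1+u^2} + (1+u^2)|\hat\xi_n|^2\big)$. The first term is integrable by
hypothesis; by Plancherel the second integrates, up to the normalization of the transform, to
$\|\xi_n\|^2+\|\xi_n'\|^2 = O(n)$. So $\sqrt m\,\hat\xi_n$ lies in $L^1\cap L^2$, and its inverse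
transform is continuous and bounded by its $L^1$ norm (`exists_continuous_opS_hermite`).

On the algebraic side, coefficients of linear growth are harmless. The numbers $c_{\{k\}}^{-2d}$
decrease and are summable, hence are $O(1/k)$, so $\sum_k k\,c_{\{k\}}^{-4d}<\infty$
(`summable_succ_mul_weight`). For $f=\sum a_k i_k$ with $\sum|a_k|c_{\{k\}}^{-p}<\infty$, the
coefficient of $T_fg$ at $\gamma$ is at most this norm of $a$ times a seminorm of $g$ times
$c_\gamma^p$ (`norm_opT_le`). Coefficient bounds of the form $\varepsilon c_\gamma^p$ with
$\varepsilon\to0$ force strong convergence, since test elements absorb every power of the weights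
(`DistSpace.tendsto_of_growth`). Thus $T_fg$ is continuous in $g$ and in $a$.

It remains to study the sequences $a_k(t)=\int_0^t S_m\xi_{k+1}$. They are differentiable in $t$ for
each $k$, with difference quotients bounded by a constant times $k+1$, so dominated convergence of
series yields convergence in the norm of $a$ (`tendsto_coeffNorm_sub`). The derivative $W_m(t)$ is
$T_f$ for $f=\sum (S_m\xi_n)(t)\,i_n$, formed with the continuous representatives. -/

lemma one_le_weight (h0 : φ 0 = 0) (hφ : Monotone φ) (α : Finset ℕ) : 1 ≤ weight φ α := by
  refine Real.one_le_exp (Finset.sum_nonneg fun k _ => ?_)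
  rw [← h0]
  exact hφ (Nat.zero_le _)

lemma weight_mono (h0 : φ 0 = 0) (hφ : Monotone φ) {α β : Finset ℕ} (h : α ⊆ β) :
    weight φ α ≤ weight φ β := by
  refine Real.exp_le_exp.2 (Finset.sum_le_sum_of_subset_of_nonneg h fun k _ _ => ?_)
  rw [← h0]
  exact hφ (Nat.zero_le _)

lemma weight_singleton_mono (hφ : Monotone φ) {j k : ℕ} (h : j ≤ k) :
    weight φ {j} ≤ weight φ {k} := by
  simp only [weight, Finset.sum_singleton]
  exact Real.exp_le_exp.2 (hφ (by omega))

lemma norm_series_mul_weight_le (p : ℤ) (g : TestSpace φ) (α : Finset ℕ) :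
    ‖g.series α‖ * weight φ α ^ p ≤ g.normH p := by
  have h := lp.norm_apply_le_norm (p := 2) (by norm_num) (g.toL2 p) α
  have h1 : ‖(g.toL2 p) α‖ = ‖g.series α‖ * weight φ α ^ p := by
    change ‖g.series α * ((weight φ α ^ p : ℝ) : ℂ)‖ = _
    rw [norm_mul, Complex.norm_real, Real.norm_of_nonneg (zpow_pos (weight_pos φ α) _).le]
  rw [← h1]
  exact h

lemma norm_series_le (p : ℤ) (g : TestSpace φ) (α : Finset ℕ) :
    ‖g.series α‖ ≤ g.normH p * weight φ α ^ (-p) := by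
  rw [zpow_neg, ← div_eq_mul_inv, le_div_iff₀ (zpow_pos (weight_pos φ α) _)]
  exact norm_series_mul_weight_le p g α

lemma normH_nonneg (p : ℤ) (g : TestSpace φ) : 0 ≤ g.normH p := norm_nonneg _

lemma toL2_sub (p : ℤ) (g h : TestSpace φ) : (g - h).toL2 p = g.toL2 p - h.toL2 p := by
  ext α
  change (g.series α - h.series α) * ((weight φ α ^ p : ℝ) : ℂ) =
    g.series α * ((weight φ α ^ p : ℝ) : ℂ) - h.series α * ((weight φ α ^ p : ℝ) : ℂ)
  ring

lemma continuous_toL2 (p : ℤ) : Continuous (TestSpace.toL2 (φ := φ) p) :=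
  continuous_iInf_dom continuous_induced_dom

lemma tendsto_normH_sub (p : ℤ) (g₀ : TestSpace φ) :
    Tendsto (fun g : TestSpace φ => (g - g₀).normH p) (𝓝 g₀) (𝓝 0) := by
  have h := ((continuous_toL2 p).tendsto g₀).sub_const (g₀.toL2 p)
  rw [sub_self] at h
  simpa only [TestSpace.normH, toL2_sub, norm_zero] using h.norm

end Weights

/-! ### Convergence in the strong dual -/

section Strong

variable {φ : ℕ → ℝ} {d : ℕ}

/-- The sum `∑ c_α^{-2d}`. -/
def weightSum (φ : ℕ → ℝ) (d : ℕ) : ℝ := ∑' α, weight φ α ^ (-2 * (d : ℤ))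

lemma weightSum_nonneg : 0 ≤ weightSum φ d :=
  tsum_nonneg fun α => (zpow_pos (weight_pos φ α) _).le

/-- Test elements decay fast enough to absorb any power of the weights. -/
lemma norm_series_mul_zpow_le (p : ℤ) (g : TestSpace φ) (α : Finset ℕ) :
    ‖g.series α‖ * weight φ α ^ p ≤
      g.normH (p + 2 * d) * weight φ α ^ (-2 * (d : ℤ)) := by
  refine (mul_le_mul_of_nonneg_right (norm_series_le (p + 2 * d) g α)
    (zpow_pos (weight_pos φ α) p).le).trans_eq ?_
  rw [mul_assoc, ← zpow_add₀ (weight_pos φ α).ne']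
  congr 2
  ring

lemma summable_norm_series_mul_zpow
    (hd : Summable fun α : Finset ℕ => weight φ α ^ (-2 * (d : ℤ)))
    (p : ℤ) (g : TestSpace φ) : Summable fun α => ‖g.series α‖ * weight φ α ^ p :=
  Summable.of_nonneg_of_le
    (fun α => mul_nonneg (norm_nonneg _) (zpow_pos (weight_pos φ α) _).le)
    (norm_series_mul_zpow_le p g) (hd.mul_left _)

lemma tsum_norm_series_mul_zpow_le
    (hd : Summable fun α : Finset ℕ => weight φ α ^ (-2 * (d : ℤ)))
    (p : ℤ) (g : TestSpace φ) :
    ∑' α, ‖g.series α‖ * weight φ α ^ p ≤ g.normH (p + 2 * d) * weightSum φ d := by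
  rw [weightSum, ← tsum_mul_left]
  exact (summable_norm_series_mul_zpow hd p g).tsum_le_tsum (norm_series_mul_zpow_le p g)
    (hd.mul_left _)

lemma summable_mul_of_growth
    (hd : Summable fun α : Finset ℕ => weight φ α ^ (-2 * (d : ℤ)))
    {F : Series} {ε : ℝ} {p : ℤ} (hF : ∀ α, ‖F α‖ ≤ ε * weight φ α ^ p) (g : TestSpace φ) :
    Summable fun α => F α * conj (g.series α) := by
  refine Summable.of_norm_bounded ((summable_norm_series_mul_zpow hd p g).mul_left ε) fun α => ?_
  rw [norm_mul, RCLike.norm_conj]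
  exact (mul_le_mul_of_nonneg_right (hF α) (norm_nonneg _)).trans_eq (by ring)

/-- The test element enters only through one of its norms, so the bound is uniform over bounded
subsets of $\mathfrak S_1$. -/
lemma norm_pairing_le
    (hd : Summable fun α : Finset ℕ => weight φ α ^ (-2 * (d : ℤ)))
    {F : Series} {ε : ℝ} {p : ℤ} (hF : ∀ α, ‖F α‖ ≤ ε * weight φ α ^ p) (g : TestSpace φ) :
    ‖pairing F g.series‖ ≤ ε * (g.normH (p + 2 * d) * weightSum φ d) := by
  have hε : 0 ≤ ε := by
    have := (norm_nonneg _).trans (hF ∅)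
    exact nonneg_of_mul_nonneg_left this (zpow_pos (weight_pos φ ∅) p)
  refine (tsum_of_norm_bounded ((summable_norm_series_mul_zpow hd p g).mul_left ε).hasSum
    fun α => ?_).trans ?_
  · rw [norm_mul, RCLike.norm_conj]
    exact (mul_le_mul_of_nonneg_right (hF α) (norm_nonneg _)).trans_eq (by ring)
  · rw [tsum_mul_left]
    exact mul_le_mul_of_nonneg_left (tsum_norm_series_mul_zpow_le hd p g) hε

lemma mem_distSeries_of_growth (h0 : φ 0 = 0) (hφ : Monotone φ)
    (hd : Summable fun α : Finset ℕ => weight φ α ^ (-2 * (d : ℤ)))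
    {F : Series} {ε : ℝ} {p : ℤ} (hF : ∀ α, ‖F α‖ ≤ ε * weight φ α ^ p) :
    F ∈ distSeries φ := by
  -- The extra $d$ leaves $c_\alpha^{2p-2(p+d)}=c_\alpha^{-2d}$, which is summable.
  refine (mem_distSeries_iff h0 hφ).2 ⟨p + d, ?_⟩
  refine Summable.of_nonneg_of_le (fun α => ?_) (fun α => ?_) (hd.mul_left (ε ^ 2))
  · have := weight_pos φ α
    positivity
  · have hw := weight_pos φ α
    have h1 : ‖F α‖ ^ 2 ≤ (ε * weight φ α ^ p) ^ 2 := pow_le_pow_left₀ (norm_nonneg _) (hF α) 2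
    refine (mul_le_mul_of_nonneg_right h1 (zpow_pos hw _).le).trans_eq ?_
    rw [mul_pow, mul_assoc, ← zpow_natCast (weight φ α ^ p), ← zpow_mul, ← zpow_add₀ hw.ne']
    congr 2
    push_cast
    ring

/-- Each term of a convergent sum of nonnegative terms is at most the sum. With
`mem_distSeries_of_growth`, this characterizes distributions by polynomial growth in the weights. -/
lemma DistSpace.exists_growth (h0 : φ 0 = 0) (hφ : Monotone φ) (F : DistSpace φ) :
    ∃ (C : ℝ) (p : ℤ), ∀ α, ‖F.series α‖ ≤ C * weight φ α ^ p := by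
  obtain ⟨p, hp⟩ := (mem_distSeries_iff h0 hφ).1 F.2
  refine ⟨√(∑' α, ‖F.series α‖ ^ 2 * weight φ α ^ (2 * -p)), p, fun α => ?_⟩
  have hw := weight_pos φ α
  have h1 : ‖F.series α‖ ^ 2 * weight φ α ^ (2 * -p) ≤
      ∑' α, ‖F.series α‖ ^ 2 * weight φ α ^ (2 * -p) :=
    Summable.le_tsum hp α fun β _ => by
      have := weight_pos φ β
      positivity
  have h2 : ‖F.series α‖ * weight φ α ^ (-p) ≤
      √(∑' α, ‖F.series α‖ ^ 2 * weight φ α ^ (2 * -p)) := by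
    refine Real.le_sqrt_of_sq_le (le_trans (le_of_eq ?_) h1)
    rw [mul_pow, ← zpow_natCast (weight φ α ^ (-p)), ← zpow_mul]
    congr 2
    push_cast
    ring
  rwa [zpow_neg, ← div_eq_mul_inv, div_le_iff₀ (zpow_pos hw _)] at h2

/-- Coefficientwise convergence that is uniform relative to a power of the weights implies strong
convergence. -/
lemma DistSpace.tendsto_of_growth (h0 : φ 0 = 0) (hφ : Monotone φ)
    (hd : Summable fun α : Finset ℕ => weight φ α ^ (-2 * (d : ℤ)))
    {ι : Type*} {l : Filter ι} {F : ι → DistSpace φ} {F₀ : DistSpace φ} {ε : ι → ℝ} {p : ℤ}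
    (hε : Tendsto ε l (𝓝 0))
    (h : ∀ᶠ i in l, ∀ α, ‖(F i - F₀).series α‖ ≤ ε i * weight φ α ^ p) :
    Tendsto F l (𝓝 F₀) := by
  rw [nhds_induced, tendsto_comap_iff, UniformOnFun.tendsto_iff_tendstoUniformlyOn]
  intro B hB
  obtain ⟨C, hC⟩ := hB (p + 2 * d)
  rw [Metric.tendstoUniformlyOn_iff]
  intro δ hδ
  have h1 : Tendsto (fun i => ε i * (C * weightSum φ d)) l (𝓝 0) := by
    simpa using hε.mul_const (C * weightSum φ d)
  filter_upwards [h, h1.eventually (gt_mem_nhds hδ)] with i hi hi' g hg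
  -- These separate growth bounds serve only to split the pairing of the difference into two
  -- convergent series; the estimate itself comes from `hi`.
  obtain ⟨C₀, p₀, h₀⟩ := DistSpace.exists_growth h0 hφ F₀
  obtain ⟨C₁, p₁, h₁⟩ := DistSpace.exists_growth h0 hφ (F i)
  have hε : 0 ≤ ε i := by
    have := (norm_nonneg _).trans (hi ∅)
    exact nonneg_of_mul_nonneg_left this (zpow_pos (weight_pos φ ∅) p)
  have h2 : pairing (F i - F₀).series g.series =
      pairing (F i).series g.series - pairing F₀.series g.series := by
    unfold pairing
    rw [← (summable_mul_of_growth hd h₁ g).tsum_sub (summable_mul_of_growth hd h₀ g)]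
    refine tsum_congr fun α => ?_
    rw [← sub_mul]
    rfl
  change dist (pairing F₀.series g.series) (pairing (F i).series g.series) < δ
  rw [dist_comm, dist_eq_norm, ← h2]
  refine ((norm_pairing_le hd hi g).trans ?_).trans_lt hi'
  exact mul_le_mul_of_nonneg_left (mul_le_mul_of_nonneg_right (hC g hg) weightSum_nonneg) hε

end Strong

/-! ### Multiplication by series of degree one -/

section Linear

variable {φ : ℕ → ℝ} {d : ℕ} {p : ℤ}

lemma norm_grassmannSign (α β : Finset ℕ) : ‖grassmannSign α β‖ = 1 := by
  simp [grassmannSign]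

lemma norm_linearSeries_le (a : ℕ → ℂ) {α γ : Finset ℕ} (h : α ⊆ γ) :
    ‖linearSeries a α‖ ≤ ∑ k ∈ γ, if α = {k} then ‖a k‖ else 0 := by
  refine (norm_sum_le _ _).trans ((Finset.sum_le_sum_of_subset_of_nonneg h
    fun k _ _ => norm_nonneg _).trans_eq (Finset.sum_congr rfl fun k _ => ?_))
  split_ifs <;> simp

/-- Among the splittings of $\gamma$ only those whose first part is a singleton $\{k\}$,
$k\in\gamma$, contribute, and signs have modulus one. -/
lemma norm_grassmannMul_linearSeries_le (a : ℕ → ℂ) {g : Series} {B : ℝ} (hg : ∀ α, ‖g α‖ ≤ B)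
    (γ : Finset ℕ) : ‖grassmannMul (linearSeries a) g γ‖ ≤ (∑ k ∈ γ, ‖a k‖) * B := by
  have hB : 0 ≤ B := (norm_nonneg _).trans (hg ∅)
  calc ‖grassmannMul (linearSeries a) g γ‖
      ≤ ∑ α ∈ γ.powerset, (∑ k ∈ γ, if α = {k} then ‖a k‖ else 0) * B := by
        refine (norm_sum_le _ _).trans (Finset.sum_le_sum fun α hα => ?_)
        rw [norm_mul, norm_mul, norm_grassmannSign, one_mul]
        exact mul_le_mul (norm_linearSeries_le a (Finset.mem_powerset.1 hα)) (hg _)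
          (norm_nonneg _) (Finset.sum_nonneg fun k _ => by split_ifs <;> simp)
    _ = (∑ k ∈ γ, ‖a k‖) * B := by
        rw [← Finset.sum_mul, Finset.sum_comm]
        congr 1
        refine Finset.sum_congr rfl fun k hk => ?_
        rw [Finset.sum_ite_eq' γ.powerset {k} fun _ => ‖a k‖, if_pos]
        simpa using hk

/-- The norm `∑ |a_k| c_{k+1}^{-p}` on sequences of coefficients. -/
def coeffNorm (φ : ℕ → ℝ) (p : ℤ) (a : ℕ → ℂ) : ℝ := ∑' k, ‖a k‖ * weight φ {k} ^ (-p)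

/-- The sequences of coefficients with `∑ |a_k| c_{k+1}^{-p} < ∞`. -/
def CoeffSummable (φ : ℕ → ℝ) (p : ℤ) (a : ℕ → ℂ) : Prop :=
  Summable fun k => ‖a k‖ * weight φ {k} ^ (-p)

lemma coeffNorm_nonneg (a : ℕ → ℂ) : 0 ≤ coeffNorm φ p a :=
  tsum_nonneg fun _ => mul_nonneg (norm_nonneg _) (zpow_pos (weight_pos φ _) _).le

lemma CoeffSummable.sub {a b : ℕ → ℂ} (ha : CoeffSummable φ p a) (hb : CoeffSummable φ p b) :
    CoeffSummable φ p (a - b) := by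
  refine Summable.of_nonneg_of_le (fun k => ?_) (fun k => ?_) (Summable.add ha hb)
  · exact mul_nonneg (norm_nonneg _) (zpow_pos (weight_pos φ _) _).le
  · rw [← add_mul]
    exact mul_le_mul_of_nonneg_right (norm_sub_le _ _) (zpow_pos (weight_pos φ _) _).le

lemma CoeffSummable.smul {a : ℕ → ℂ} (ha : CoeffSummable φ p a) (r : ℂ) :
    CoeffSummable φ p (r • a) := by
  refine (Summable.mul_left ‖r‖ ha).congr fun k => ?_
  simp only [Pi.smul_apply, norm_smul]
  ring

/-- For $k\in\gamma$ one has $c_{\{k\}}\le c_\gamma$, so $|a_k| \le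
|a_k|c_{\{k\}}^{-p}\,c_\gamma^p$. This is where $p\ge0$ matters. -/
lemma sum_norm_le_coeffNorm (h0 : φ 0 = 0) (hφ : Monotone φ) (hp : 0 ≤ p) {a : ℕ → ℂ}
    (ha : CoeffSummable φ p a) (γ : Finset ℕ) :
    ∑ k ∈ γ, ‖a k‖ ≤ coeffNorm φ p a * weight φ γ ^ p := by
  calc ∑ k ∈ γ, ‖a k‖ ≤ ∑ k ∈ γ, ‖a k‖ * weight φ {k} ^ (-p) * weight φ γ ^ p := by
        refine Finset.sum_le_sum fun k hk => ?_
        have hw := weight_pos φ {k}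
        have h1 : weight φ {k} ^ p ≤ weight φ γ ^ p :=
          zpow_le_zpow_left₀ hp hw.le (weight_mono h0 hφ (by simpa using hk))
        have h2 : ‖a k‖ = ‖a k‖ * weight φ {k} ^ (-p) * weight φ {k} ^ p := by
          rw [mul_assoc, ← zpow_add₀ hw.ne', neg_add_cancel, zpow_zero, mul_one]
        exact h2.le.trans (mul_le_mul_of_nonneg_left h1
          (mul_nonneg (norm_nonneg _) (zpow_pos hw _).le))
    _ ≤ coeffNorm φ p a * weight φ γ ^ p := by
        rw [← Finset.sum_mul]
        refine mul_le_mul_of_nonneg_right ?_ (zpow_pos (weight_pos φ _) _).le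
        exact Summable.sum_le_tsum γ
          (fun k _ => mul_nonneg (norm_nonneg _) (zpow_pos (weight_pos φ _) _).le) ha

lemma norm_linearSeries_le_coeffNorm (h0 : φ 0 = 0) (hφ : Monotone φ) (hp : 0 ≤ p) {a : ℕ → ℂ}
    (ha : CoeffSummable φ p a) (γ : Finset ℕ) :
    ‖linearSeries a γ‖ ≤ coeffNorm φ p a * weight φ γ ^ p := by
  refine (norm_linearSeries_le a subset_rfl).trans
    ((Finset.sum_le_sum fun k _ => ?_).trans (sum_norm_le_coeffNorm h0 hφ hp ha γ))
  split_ifs <;> simp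

lemma norm_basisSeries_le (γ α : Finset ℕ) : ‖basisSeries γ α‖ ≤ 1 := by
  unfold basisSeries
  split_ifs <;> simp

lemma norm_adjoint_term_le (h0 : φ 0 = 0) (hφ : Monotone φ) (hp : 0 ≤ p) {a : ℕ → ℂ}
    (ha : CoeffSummable φ p a) (g : Series) (γ β : Finset ℕ) :
    ‖g β * conj (grassmannMul (linearSeries a) (basisSeries γ) β)‖ ≤
      coeffNorm φ p a * (‖g β‖ * weight φ β ^ p) := by
  rw [norm_mul, RCLike.norm_conj]
  have h1 := norm_grassmannMul_linearSeries_le a (norm_basisSeries_le γ) β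
  rw [mul_one] at h1
  exact (mul_le_mul_of_nonneg_left (h1.trans (sum_norm_le_coeffNorm h0 hφ hp ha β))
    (norm_nonneg _)).trans_eq (by ring)

lemma summable_adjoint (h0 : φ 0 = 0) (hφ : Monotone φ)
    (hd : Summable fun α : Finset ℕ => weight φ α ^ (-2 * (d : ℤ))) (hp : 0 ≤ p) {a : ℕ → ℂ}
    (ha : CoeffSummable φ p a) (g : TestSpace φ) (γ : Finset ℕ) :
    Summable fun β => g.series β * conj (grassmannMul (linearSeries a) (basisSeries γ) β) :=
  Summable.of_norm_bounded ((summable_norm_series_mul_zpow hd p g).mul_left _)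
    (norm_adjoint_term_le h0 hφ hp ha g.series γ)

lemma norm_adjointMul_le (h0 : φ 0 = 0) (hφ : Monotone φ)
    (hd : Summable fun α : Finset ℕ => weight φ α ^ (-2 * (d : ℤ))) (hp : 0 ≤ p) {a : ℕ → ℂ}
    (ha : CoeffSummable φ p a) (g : TestSpace φ) (γ : Finset ℕ) :
    ‖adjointMul (linearSeries a) g.series γ‖ ≤
      coeffNorm φ p a * (g.normH (p + 2 * d) * weightSum φ d) := by
  refine (tsum_of_norm_bounded ((summable_norm_series_mul_zpow hd p g).mul_left _).hasSum
    (norm_adjoint_term_le h0 hφ hp ha g.series γ)).trans ?_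
  rw [tsum_mul_left]
  exact mul_le_mul_of_nonneg_left (tsum_norm_series_mul_zpow_le hd p g) (coeffNorm_nonneg a)

/-- The product part grows like $c_\gamma^p$. The adjoint part is bounded independently of $\gamma$,
because there $g$ absorbs the weights, and $1\le c_\gamma^p$ merges the two bounds. -/
lemma norm_opT_le (h0 : φ 0 = 0) (hφ : Monotone φ)
    (hd : Summable fun α : Finset ℕ => weight φ α ^ (-2 * (d : ℤ))) (hp : 0 ≤ p) {a : ℕ → ℂ}
    (ha : CoeffSummable φ p a) (g : TestSpace φ) (γ : Finset ℕ) :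
    ‖opT (linearSeries a) g.series γ‖ ≤
      coeffNorm φ p a * (g.normH 0 + g.normH (p + 2 * d) * weightSum φ d) * weight φ γ ^ p := by
  have hw : 1 ≤ weight φ γ ^ p := one_le_zpow₀ (one_le_weight h0 hφ γ) hp
  have h1 : ‖grassmannMul (linearSeries a) g.series γ‖ ≤
      coeffNorm φ p a * weight φ γ ^ p * g.normH 0 :=
    (norm_grassmannMul_linearSeries_le a (fun α => by simpa using norm_series_le 0 g α) γ).trans
      (mul_le_mul_of_nonneg_right (sum_norm_le_coeffNorm h0 hφ hp ha γ) (normH_nonneg 0 g))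
  have h2 := (norm_adjointMul_le h0 hφ hd hp ha g γ).trans (le_mul_of_one_le_right
    (mul_nonneg (coeffNorm_nonneg a) (mul_nonneg (normH_nonneg _ g) weightSum_nonneg)) hw)
  refine (norm_add_le _ _).trans ((add_le_add h1 h2).trans_eq (by ring))

/-! ### Linearity in each argument, and the resulting operators -/

lemma linearSeries_sub (a b : ℕ → ℂ) :
    linearSeries (a - b) = linearSeries a - linearSeries b := by
  funext α
  simp only [linearSeries, Pi.sub_apply, ← Finset.sum_sub_distrib]
  refine Finset.sum_congr rfl fun k _ => ?_
  split_ifs <;> simp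

lemma linearSeries_smul (r : ℂ) (a : ℕ → ℂ) : linearSeries (r • a) = r • linearSeries a := by
  funext α
  simp only [linearSeries, Pi.smul_apply, Finset.smul_sum]
  refine Finset.sum_congr rfl fun k _ => ?_
  split_ifs <;> simp

lemma grassmannMul_sub_left (f f' g : Series) :
    grassmannMul (f - f') g = grassmannMul f g - grassmannMul f' g := by
  funext γ
  simp only [grassmannMul, Pi.sub_apply, ← Finset.sum_sub_distrib]
  exact Finset.sum_congr rfl fun α _ => by ring

lemma grassmannMul_smul_left (r : ℂ) (f g : Series) :
    grassmannMul (r • f) g = r • grassmannMul f g := by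
  funext γ
  simp only [grassmannMul, Pi.smul_apply, Finset.mul_sum, smul_eq_mul]
  exact Finset.sum_congr rfl fun α _ => by ring

lemma grassmannMul_add_right (f g g' : Series) :
    grassmannMul f (g + g') = grassmannMul f g + grassmannMul f g' := by
  funext γ
  simp only [grassmannMul, Pi.add_apply, ← Finset.sum_add_distrib]
  exact Finset.sum_congr rfl fun α _ => by ring

lemma grassmannMul_smul_right (r : ℂ) (f g : Series) :
    grassmannMul f (r • g) = r • grassmannMul f g := by
  funext γ
  simp only [grassmannMul, Pi.smul_apply, Finset.mul_sum, smul_eq_mul]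
  exact Finset.sum_congr rfl fun α _ => by ring

lemma opT_smul_right (r : ℂ) (f g : Series) : opT f (r • g) = r • opT f g := by
  have h : adjointMul f (r • g) = r • adjointMul f g := by
    funext γ
    simp only [adjointMul, pairing, Pi.smul_apply, smul_eq_mul, ← tsum_mul_left]
    exact tsum_congr fun β => by ring
  rw [opT, opT, h, grassmannMul_smul_right, smul_add]

lemma opT_add_right (h0 : φ 0 = 0) (hφ : Monotone φ)
    (hd : Summable fun α : Finset ℕ => weight φ α ^ (-2 * (d : ℤ))) (hp : 0 ≤ p) {a : ℕ → ℂ}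
    (ha : CoeffSummable φ p a) (g g' : TestSpace φ) :
    opT (linearSeries a) (g.series + g'.series) =
      opT (linearSeries a) g.series + opT (linearSeries a) g'.series := by
  have h : adjointMul (linearSeries a) (g.series + g'.series) =
      adjointMul (linearSeries a) g.series + adjointMul (linearSeries a) g'.series := by
    funext γ
    simp only [adjointMul, pairing, Pi.add_apply]
    rw [← (summable_adjoint h0 hφ hd hp ha g γ).tsum_add (summable_adjoint h0 hφ hd hp ha g' γ)]
    exact tsum_congr fun β => by ring
  rw [opT, opT, opT, h, grassmannMul_add_right]
  abel

lemma opT_sub_left (h0 : φ 0 = 0) (hφ : Monotone φ)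
    (hd : Summable fun α : Finset ℕ => weight φ α ^ (-2 * (d : ℤ))) (hp : 0 ≤ p) {a b : ℕ → ℂ}
    (ha : CoeffSummable φ p a) (hb : CoeffSummable φ p b) (g : TestSpace φ) :
    opT (linearSeries (a - b)) g.series =
      opT (linearSeries a) g.series - opT (linearSeries b) g.series := by
  have h : adjointMul (linearSeries (a - b)) g.series =
      adjointMul (linearSeries a) g.series - adjointMul (linearSeries b) g.series := by
    funext γ
    simp only [adjointMul, pairing, Pi.sub_apply]
    rw [← (summable_adjoint h0 hφ hd hp ha g γ).tsum_sub (summable_adjoint h0 hφ hd hp hb g γ)]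
    refine tsum_congr fun β => ?_
    rw [linearSeries_sub, grassmannMul_sub_left, Pi.sub_apply, map_sub]
    ring
  rw [opT, opT, opT, h, linearSeries_sub, grassmannMul_sub_left]
  abel

/-- The scalar must be real: $M_f$ is linear in $f$ but $M_f^*$ is conjugate-linear. -/
lemma opT_real_smul_left (r : ℝ) (a : ℕ → ℂ) (g : Series) :
    opT (linearSeries ((r : ℂ) • a)) g = (r : ℂ) • opT (linearSeries a) g := by
  have h : adjointMul (linearSeries ((r : ℂ) • a)) g = (r : ℂ) • adjointMul (linearSeries a) g := by
    funext γ
    simp only [adjointMul, pairing, Pi.smul_apply, smul_eq_mul, ← tsum_mul_left]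
    refine tsum_congr fun β => ?_
    rw [linearSeries_smul, grassmannMul_smul_left, Pi.smul_apply, smul_eq_mul, map_mul,
      Complex.conj_ofReal]
    ring
  rw [opT, opT, h, linearSeries_smul, grassmannMul_smul_left, smul_add]

/-- `T_f` for `f = ∑ a_k i_{k+1}`, as a continuous operator from `𝔖_1` to `𝔖_{-1}`. -/
def linearOp (h0 : φ 0 = 0) (hφ : Monotone φ)
    (hd : Summable fun α : Finset ℕ => weight φ α ^ (-2 * (d : ℤ))) (hp : 0 ≤ p) (a : ℕ → ℂ)
    (ha : CoeffSummable φ p a) : TestSpace φ →L[ℂ] DistSpace φ where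
  toFun g := ⟨opT (linearSeries a) g.series,
    mem_distSeries_of_growth h0 hφ hd (norm_opT_le h0 hφ hd hp ha g)⟩
  map_add' g g' := Subtype.ext (opT_add_right h0 hφ hd hp ha g g')
  map_smul' r g := Subtype.ext (opT_smul_right r _ g.series)
  cont := by
    refine continuous_iff_continuousAt.2 fun g₀ => ?_
    -- By additivity, the growth bound for $T_f$ applied to $g-g_0$ controls the difference of the
    -- values; its constant tends to zero.
    have h1 : Tendsto (fun g : TestSpace φ => coeffNorm φ p a * ((g - g₀).normH 0 +
        (g - g₀).normH (p + 2 * d) * weightSum φ d)) (𝓝 g₀) (𝓝 0) := by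
      simpa using ((tendsto_normH_sub 0 g₀).add
        ((tendsto_normH_sub (p + 2 * d) g₀).mul_const (weightSum φ d))).const_mul
          (coeffNorm φ p a)
    refine DistSpace.tendsto_of_growth (p := p) h0 hφ hd h1 (Eventually.of_forall fun g α => ?_)
    have h2 := opT_add_right h0 hφ hd hp ha (g - g₀) g₀
    have h3 : (g - g₀).series + g₀.series = g.series := sub_add_cancel g.series g₀.series
    rw [h3] at h2
    have h4 : opT (linearSeries a) g.series - opT (linearSeries a) g₀.series =
        opT (linearSeries a) (g - g₀).series := by rw [h2, add_sub_cancel_right]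
    change ‖(opT (linearSeries a) g.series - opT (linearSeries a) g₀.series) α‖ ≤ _
    rw [h4]
    exact norm_opT_le h0 hφ hd hp ha (g - g₀) α

lemma linearOp_sub_apply (h0 : φ 0 = 0) (hφ : Monotone φ)
    (hd : Summable fun α : Finset ℕ => weight φ α ^ (-2 * (d : ℤ))) (hp : 0 ≤ p) {a b : ℕ → ℂ}
    (ha : CoeffSummable φ p a) (hb : CoeffSummable φ p b) (g : TestSpace φ) :
    linearOp h0 hφ hd hp a ha g - linearOp h0 hφ hd hp b hb g =
      linearOp h0 hφ hd hp (a - b) (ha.sub hb) g :=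
  Subtype.ext (opT_sub_left h0 hφ hd hp ha hb g).symm

lemma real_smul_linearOp_apply (h0 : φ 0 = 0) (hφ : Monotone φ)
    (hd : Summable fun α : Finset ℕ => weight φ α ^ (-2 * (d : ℤ))) (hp : 0 ≤ p) {a : ℕ → ℂ}
    (ha : CoeffSummable φ p a) (r : ℝ) (g : TestSpace φ) :
    (r : ℂ) • linearOp h0 hφ hd hp a ha g =
      linearOp h0 hφ hd hp ((r : ℂ) • a) (ha.smul r) g :=
  Subtype.ext (opT_real_smul_left r a g.series).symm

/-- `T_f g` depends continuously on `f`. -/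
lemma tendsto_linearOp_apply (h0 : φ 0 = 0) (hφ : Monotone φ)
    (hd : Summable fun α : Finset ℕ => weight φ α ^ (-2 * (d : ℤ))) (hp : 0 ≤ p)
    {ι : Type*} {l : Filter ι} {a : ι → ℕ → ℂ} {b : ℕ → ℂ}
    (ha : ∀ i, CoeffSummable φ p (a i)) (hb : CoeffSummable φ p b)
    (h : Tendsto (fun i => coeffNorm φ p (a i - b)) l (𝓝 0)) (g : TestSpace φ) :
    Tendsto (fun i => linearOp h0 hφ hd hp (a i) (ha i) g) l
      (𝓝 (linearOp h0 hφ hd hp b hb g)) := by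
  have h1 : Tendsto (fun i => coeffNorm φ p (a i - b) *
      (g.normH 0 + g.normH (p + 2 * d) * weightSum φ d)) l (𝓝 0) := by
    simpa using h.mul_const (g.normH 0 + g.normH (p + 2 * d) * weightSum φ d)
  refine DistSpace.tendsto_of_growth (p := p) h0 hφ hd h1 (Eventually.of_forall fun i α => ?_)
  rw [linearOp_sub_apply]
  exact norm_opT_le h0 hφ hd hp ((ha i).sub hb) g α

end Linear

end GrassmannProcess

end

noncomputable section

namespace GrassmannProcess

open Polynomial SchwartzMap

/-! ### Polynomials times the Gaussian -/

/-- The function `P(x) e^{-x²/2}`. -/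
def polyGauss (P : ℝ[X]) (x : ℝ) : ℝ := P.eval x * Real.exp (-(x ^ 2 / 2))

lemma hasDerivAt_polyGauss (P : ℝ[X]) (x : ℝ) :
    HasDerivAt (polyGauss P) (polyGauss (derivative P - X * P) x) x := by
  have h1 : HasDerivAt (fun x : ℝ => Real.exp (-(x ^ 2 / 2)))
      (Real.exp (-(x ^ 2 / 2)) * (-x)) x := by
    have := (((hasDerivAt_pow 2 x).div_const 2).fun_neg).exp
    convert this using 1
    simp
  refine ((P.hasDerivAt x).mul h1).congr_deriv ?_
  simp only [polyGauss, eval_sub, eval_mul, eval_X]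
  ring

lemma contDiff_polyGauss (P : ℝ[X]) {n : WithTop ℕ∞} : ContDiff ℝ n (polyGauss P) := by
  unfold polyGauss
  have : ContDiff ℝ n fun x : ℝ => P.eval x := by
    simpa using P.contDiff_aeval (𝕜 := ℝ) n
  fun_prop

lemma exists_abs_pow_mul_exp_le (n : ℕ) :
    ∃ C : ℝ, ∀ x : ℝ, |x| ^ n * Real.exp (-(x ^ 2 / 2)) ≤ C := by
  -- From $|x|^n\le 1+x^{2n}$ and $y^n/n!\le e^y$ at $y=x^2/2$.
  refine ⟨1 + 2 ^ n * n.factorial, fun x => ?_⟩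
  have he : Real.exp (-(x ^ 2 / 2)) ≤ 1 := Real.exp_le_one_iff.2 (by nlinarith [sq_nonneg x])
  have hn : (0 : ℝ) < n.factorial := by positivity
  have h1 : (x ^ 2 / 2) ^ n * Real.exp (-(x ^ 2 / 2)) ≤ n.factorial := by
    have h := Real.pow_div_factorial_le_exp (x ^ 2 / 2) (by positivity) n
    rw [div_le_iff₀ hn] at h
    refine (mul_le_mul_of_nonneg_right h (Real.exp_pos _).le).trans_eq ?_
    rw [mul_right_comm, ← Real.exp_add, add_neg_cancel, Real.exp_zero, one_mul]
  have h2 : |x| ^ n ≤ 1 + (x ^ 2) ^ n := by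
    rw [← sq_abs, ← pow_mul, mul_comm 2 n, pow_mul]
    nlinarith [sq_nonneg (|x| ^ n - 1), pow_nonneg (abs_nonneg x) n]
  calc |x| ^ n * Real.exp (-(x ^ 2 / 2))
      ≤ (1 + (x ^ 2) ^ n) * Real.exp (-(x ^ 2 / 2)) :=
        mul_le_mul_of_nonneg_right h2 (Real.exp_pos _).le
    _ = Real.exp (-(x ^ 2 / 2)) + 2 ^ n * ((x ^ 2 / 2) ^ n * Real.exp (-(x ^ 2 / 2))) := by
        rw [div_pow]
        field_simp
    _ ≤ 1 + 2 ^ n * n.factorial := by gcongr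

lemma exists_abs_pow_mul_polyGauss_le (P : ℝ[X]) (n : ℕ) :
    ∃ C : ℝ, ∀ x : ℝ, |x| ^ n * |polyGauss P x| ≤ C := by
  induction P using Polynomial.induction_on' with
  | add p q hp hq =>
    obtain ⟨C, hC⟩ := hp
    obtain ⟨D, hD⟩ := hq
    refine ⟨C + D, fun x => ?_⟩
    have h : polyGauss (p + q) x = polyGauss p x + polyGauss q x := by
      simp [polyGauss, add_mul]
    rw [h]
    refine (mul_le_mul_of_nonneg_left (abs_add_le _ _) (by positivity)).trans ?_
    rw [mul_add]
    exact add_le_add (hC x) (hD x)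
  | monomial k a =>
    obtain ⟨C, hC⟩ := exists_abs_pow_mul_exp_le (n + k)
    refine ⟨|a| * C, fun x => ?_⟩
    refine le_trans (le_of_eq ?_) (mul_le_mul_of_nonneg_left (hC x) (abs_nonneg a))
    simp only [polyGauss, eval_monomial, abs_mul, abs_pow, Real.abs_exp]
    ring

/-- Differentiation preserves the form polynomial times Gaussian, so Schwartz decay only needs to be
checked for undifferentiated functions. -/
lemma iteratedDeriv_polyGauss (P : ℝ[X]) (n : ℕ) :
    iteratedDeriv n (polyGauss P) = polyGauss ((fun Q => derivative Q - X * Q)^[n] P) := by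
  induction n with
  | zero => simp
  | succ n ih =>
    rw [iteratedDeriv_succ, ih, Function.iterate_succ_apply']
    funext x
    exact (hasDerivAt_polyGauss _ x).deriv

/-- The function `P(x) e^{-x²/2}` as a Schwartz function. -/
def realPolyGaussSchwartz (P : ℝ[X]) : 𝓢(ℝ, ℝ) where
  toFun := polyGauss P
  smooth' := contDiff_polyGauss P
  decay' := fun k n => by
    obtain ⟨C, hC⟩ := exists_abs_pow_mul_polyGauss_le ((fun Q => derivative Q - X * Q)^[n] P) k
    refine ⟨C, fun x => ?_⟩
    rw [norm_iteratedFDeriv_eq_norm_iteratedDeriv, iteratedDeriv_polyGauss]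
    exact hC x

/-- The function `P(x) e^{-x²/2}` as a complex Schwartz function. -/
def polyGaussSchwartz (P : ℝ[X]) : 𝓢(ℝ, ℂ) :=
  SchwartzMap.postcompCLM (𝕜 := ℝ) Complex.ofRealCLM (realPolyGaussSchwartz P)

lemma polyGaussSchwartz_apply (P : ℝ[X]) (x : ℝ) :
    polyGaussSchwartz P x = (polyGauss P x : ℂ) := rfl

lemma deriv_polyGaussSchwartz (P : ℝ[X]) :
    deriv (polyGaussSchwartz P) = polyGaussSchwartz (derivative P - X * P) := by
  funext x
  exact (hasDerivAt_polyGauss P x).ofReal_comp.deriv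

/-- The Gaussian integral `∫ P(x) e^{-x²} dx`. -/
def gaussInt (P : ℝ[X]) : ℝ := ∫ x : ℝ, P.eval x * Real.exp (-(x ^ 2))

lemma gaussInt_add (P Q : ℝ[X]) : gaussInt (P + Q) = gaussInt P + gaussInt Q := by
  simp only [gaussInt, eval_add, add_mul]
  exact integral_add (integrable_polynomial_mul_gaussian P) (integrable_polynomial_mul_gaussian Q)

lemma gaussInt_C_mul (r : ℝ) (P : ℝ[X]) : gaussInt (C r * P) = r * gaussInt P := by
  simp only [gaussInt, eval_mul, eval_C, mul_assoc]
  exact integral_const_mul _ _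

lemma gaussInt_one : gaussInt 1 = √Real.pi := by
  simpa [gaussInt] using integral_gaussian 1

lemma gaussInt_mono {P Q : ℝ[X]} (h : ∀ x, P.eval x ≤ Q.eval x) : gaussInt P ≤ gaussInt Q :=
  integral_mono (integrable_polynomial_mul_gaussian P) (integrable_polynomial_mul_gaussian Q)
    fun x => mul_le_mul_of_nonneg_right (h x) (Real.exp_pos _).le

/-- Integration by parts against the Gaussian. -/
lemma gaussInt_derivative (P : ℝ[X]) : gaussInt (derivative P) = 2 * gaussInt (X * P) := by
  have h (x : ℝ) : HasDerivAt (fun x : ℝ => P.eval x * Real.exp (-(x ^ 2)))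
      ((derivative P - C 2 * (X * P)).eval x * Real.exp (-(x ^ 2))) x := by
    have h1 := ((hasDerivAt_pow 2 x).fun_neg).exp
    refine ((P.hasDerivAt x).mul h1).congr_deriv ?_
    simp only [eval_sub, eval_mul, eval_C, eval_X]
    push_cast
    ring
  have h2 := integral_eq_zero_of_hasDerivAt_of_integrable h
    (integrable_polynomial_mul_gaussian _) (integrable_polynomial_mul_gaussian P)
  have h3 : gaussInt (derivative P - C 2 * (X * P) + C 2 * (X * P)) = gaussInt (derivative P) := by
    rw [sub_add_cancel]
  rw [← h3, gaussInt_add, gaussInt_C_mul]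
  change (∫ x : ℝ, _) + _ = _
  rw [h2, zero_add]

lemma integral_sq_polyGaussSchwartz (P : ℝ[X]) :
    ∫ x, ‖polyGaussSchwartz P x‖ ^ 2 = gaussInt (P ^ 2) := by
  refine integral_congr_ae (Eventually.of_forall fun x => ?_)
  have he : Real.exp (-(x ^ 2)) = Real.exp (-(x ^ 2 / 2)) ^ 2 := by
    rw [← Real.exp_nat_mul]
    congr 1
    push_cast
    ring
  simp only [polyGaussSchwartz_apply, Complex.norm_real, Real.norm_eq_abs, sq_abs, polyGauss, he,
    eval_pow]
  ring

/-! ### Hermite functions -/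

lemma derivative_hermite_succ (n : ℕ) :
    derivative (hermite (n + 1)) = (n + 1 : ℤ[X]) * hermite n := by
  induction n with
  | zero => simp
  | succ n ih =>
    rw [hermite_succ (n + 1), derivative_sub, derivative_mul, ih, derivative_mul, derivative_X,
      hermite_succ n]
    have : derivative ((n : ℤ[X]) + 1) = 0 := by simp
    rw [this]
    push_cast
    ring

/-- The polynomial `He_k(√2 x)`. -/
def scaledHermite (k : ℕ) : ℝ[X] :=
  ((hermite k).map (Int.castRingHom ℝ)).comp (C √2 * X)

lemma derivative_scaledHermite_succ (k : ℕ) :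
    derivative (scaledHermite (k + 1)) = C (√2 * (k + 1)) * scaledHermite k := by
  rw [scaledHermite, derivative_comp, derivative_map, derivative_hermite_succ]
  simp [scaledHermite]
  ring

/-- The recursion in the form suited to integration by parts against $e^{-x^2}$, where the adjoint
of $P\mapsto P'$ is $P\mapsto 2XP-P'$. -/
lemma scaledHermite_succ (k : ℕ) :
    C √2 * scaledHermite (k + 1) =
      C 2 * (X * scaledHermite k) - derivative (scaledHermite k) := by
  have h2 : (C √2 : ℝ[X]) * C √2 = C 2 := by
    rw [← C_mul, Real.mul_self_sqrt (by norm_num)]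
  rw [scaledHermite, scaledHermite, hermite_succ, derivative_comp, ← h2]
  simp
  ring

/-- Integrating $(h_{k+1}h_k)'$ by parts and inserting the recursion produces $h_{k+1}h_k'$ on both
sides. It cancels, leaving $\int h_{k+1}^2e^{-x^2}=(k+1)\int h_k^2e^{-x^2}$; no orthogonality is
needed. -/
lemma gaussInt_scaledHermite_sq (k : ℕ) :
    gaussInt (scaledHermite k ^ 2) = k.factorial * √Real.pi := by
  induction k with
  | zero => simp [scaledHermite, gaussInt_one]
  | succ k ih =>
    set h := scaledHermite k
    set h' := scaledHermite (k + 1)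
    have h2 : (C √2 : ℝ[X]) * C √2 = C 2 := by
      rw [← C_mul, Real.mul_self_sqrt (by norm_num)]
    have e1 : C √2 * h' ^ 2 + h' * derivative h = C 2 * (X * (h' * h)) := by
      have := scaledHermite_succ k
      linear_combination h' * this
    have e2 : derivative (h' * h) = C (√2 * (k + 1)) * h ^ 2 + h' * derivative h := by
      rw [derivative_mul, derivative_scaledHermite_succ]
      ring
    have e3 := gaussInt_derivative (h' * h)
    have e4 := congrArg gaussInt e1
    rw [e2, gaussInt_add, gaussInt_C_mul] at e3
    rw [gaussInt_add, gaussInt_C_mul, gaussInt_C_mul] at e4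
    have hs : √2 ≠ 0 := by positivity
    have e5 : √2 * gaussInt (h' ^ 2) = √2 * ((k + 1) * gaussInt (h ^ 2)) := by linarith
    rw [mul_left_cancel₀ hs e5, ih, Nat.factorial_succ]
    push_cast
    ring

lemma gaussInt_derivative_scaledHermite_sq (k : ℕ) :
    gaussInt (derivative (scaledHermite k) ^ 2) = 2 * k * (k.factorial * √Real.pi) := by
  cases k with
  | zero => simp [scaledHermite, gaussInt]
  | succ k =>
    rw [derivative_scaledHermite_succ, mul_pow, ← C_pow, gaussInt_C_mul,
      gaussInt_scaledHermite_sq, mul_pow, Real.sq_sqrt (by norm_num), Nat.factorial_succ]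
    push_cast
    ring

/-- By the recursion, $h_k'-xh_k=\frac12(h_k'-\sqrt2\,h_{k+1})$. The pointwise inequality
$(a-b)^2\le2a^2+2b^2$ then reduces to the two known norms without evaluating the cross term. -/
lemma gaussInt_deriv_hermite_le (k : ℕ) :
    gaussInt ((derivative (scaledHermite k) - X * scaledHermite k) ^ 2) ≤
      (2 * k + 1) * (k.factorial * √Real.pi) := by
  have h := scaledHermite_succ k
  calc _ ≤ gaussInt (C (1 / 2) * derivative (scaledHermite k) ^ 2 +
        scaledHermite (k + 1) ^ 2) := by
        refine gaussInt_mono fun x => ?_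
        have hx := congrArg (Polynomial.eval x) h
        simp only [eval_mul, eval_C, eval_sub, eval_X, eval_add, eval_pow] at hx ⊢
        have h2 : √2 * √2 = 2 := Real.mul_self_sqrt (by norm_num)
        set u := eval x (scaledHermite (k + 1))
        set v := eval x (derivative (scaledHermite k))
        set w := x * eval x (scaledHermite k)
        have hw : w = (√2 * u + v) / 2 := by linarith
        rw [hw]
        nlinarith [sq_nonneg (v + √2 * u)]
    _ = _ := by
        rw [gaussInt_add, gaussInt_C_mul, gaussInt_derivative_scaledHermite_sq,
          gaussInt_scaledHermite_sq, Nat.factorial_succ]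
        push_cast
        ring

/-- The constant normalizing the Hermite functions. -/
def hermiteConst (k : ℕ) : ℝ := Real.pi ^ (-(1 / 4) : ℝ) * (√(k.factorial : ℝ))⁻¹

lemma hermiteConst_sq (k : ℕ) : hermiteConst k ^ 2 * (k.factorial * √Real.pi) = 1 := by
  have h1 : (Real.pi ^ (-(1 / 4) : ℝ)) ^ 2 * √Real.pi = 1 := by
    rw [← Real.rpow_natCast, ← Real.rpow_mul Real.pi_pos.le, Real.sqrt_eq_rpow,
      ← Real.rpow_add Real.pi_pos]
    norm_num
  have hk : (k.factorial : ℝ) ≠ 0 := by positivity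
  rw [hermiteConst, mul_pow, inv_pow, Real.sq_sqrt (by positivity)]
  calc _ = ((Real.pi ^ (-(1 / 4) : ℝ)) ^ 2 * √Real.pi) * ((k.factorial : ℝ)⁻¹ * k.factorial) := by
        ring
    _ = 1 := by rw [h1, inv_mul_cancel₀ hk, one_mul]

/-- The Hermite functions as Schwartz functions. -/
def hermiteSchwartz (k : ℕ) : 𝓢(ℝ, ℂ) := polyGaussSchwartz (C (hermiteConst k) * scaledHermite k)

lemma hermiteSchwartz_apply (k : ℕ) (x : ℝ) : hermiteSchwartz k x = (hermiteFun k x : ℂ) := by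
  rw [hermiteSchwartz, polyGaussSchwartz_apply]
  simp [polyGauss, hermiteFun, hermiteConst, scaledHermite]

lemma toLp_hermiteSchwartz (k : ℕ) : (hermiteSchwartz k).toLp 2 = hermiteL2 k :=
  (MemLp.toLp_eq_toLp_iff _ _).2 (Eventually.of_forall (hermiteSchwartz_apply k))

lemma integral_sq_hermiteSchwartz (k : ℕ) : ∫ x, ‖hermiteSchwartz k x‖ ^ 2 = 1 := by
  rw [hermiteSchwartz, integral_sq_polyGaussSchwartz, mul_pow, ← C_pow, gaussInt_C_mul,
    gaussInt_scaledHermite_sq, hermiteConst_sq]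

lemma integral_sq_deriv_hermiteSchwartz_le (k : ℕ) :
    ∫ x, ‖deriv (hermiteSchwartz k) x‖ ^ 2 ≤ 2 * k + 1 := by
  have h : derivative (C (hermiteConst k) * scaledHermite k) -
      X * (C (hermiteConst k) * scaledHermite k) =
      C (hermiteConst k) * (derivative (scaledHermite k) - X * scaledHermite k) := by
    rw [derivative_C_mul]
    ring
  rw [hermiteSchwartz, deriv_polyGaussSchwartz, integral_sq_polyGaussSchwartz, h, mul_pow,
    ← C_pow, gaussInt_C_mul]
  calc _ ≤ hermiteConst k ^ 2 * ((2 * k + 1) * (k.factorial * √Real.pi)) :=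
        mul_le_mul_of_nonneg_left (gaussInt_deriv_hermite_le k) (sq_nonneg _)
    _ = (2 * k + 1) * (hermiteConst k ^ 2 * (k.factorial * √Real.pi)) := by ring
    _ = 2 * k + 1 := by rw [hermiteConst_sq, mul_one]

/-! ### Fourier transforms -/

lemma fourier_deriv_apply (f : 𝓢(ℝ, ℂ)) (v : ℝ) :
    (𝓕 (derivCLM ℂ ℂ f) : 𝓢(ℝ, ℂ)) v = (2 * Real.pi * Complex.I * v) * (𝓕 f : 𝓢(ℝ, ℂ)) v := by
  have h := congrFun (Real.fourier_deriv f.integrable f.differentiable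
    (derivCLM ℂ ℂ f).integrable) v
  simpa [fourier_coe] using! h

/-- Plancherel's theorem for a Schwartz function and its derivative. -/
lemma integral_one_add_sq_mul_fourier (f : 𝓢(ℝ, ℂ)) :
    ∫ v, (1 + (2 * Real.pi * v) ^ 2) * ‖(𝓕 f : 𝓢(ℝ, ℂ)) v‖ ^ 2 =
      (∫ x, ‖f x‖ ^ 2) + ∫ x, ‖deriv f x‖ ^ 2 := by
  have hi (g : 𝓢(ℝ, ℂ)) : Integrable fun x => ‖g x‖ ^ 2 :=
    (memLp_two_iff_integrable_sq_norm g.continuous.aestronglyMeasurable).1 (g.memLp 2)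
  have h1 := integral_norm_sq_fourier f
  have h2 := integral_norm_sq_fourier (derivCLM ℂ ℂ f)
  simp only [derivCLM_apply] at h2
  rw [← h1, ← h2, ← integral_add (hi _) (hi _)]
  refine integral_congr_ae (Eventually.of_forall fun v => ?_)
  simp only [fourier_deriv_apply, norm_mul, Complex.norm_real, Complex.norm_I, mul_one,
    Complex.norm_ofNat, mul_pow, Real.norm_eq_abs, sq_abs]
  ring

lemma continuous_fourierInv {F : ℝ → ℂ} (hF : Integrable F) : Continuous (𝓕⁻ F) :=
  VectorFourier.fourierIntegral_continuous (L := -innerₗ ℝ) Real.continuous_fourierChar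
    continuous_inner.neg hF

lemma norm_fourierInv_le (F : ℝ → ℂ) (x : ℝ) : ‖𝓕⁻ F x‖ ≤ ∫ v, ‖F v‖ :=
  VectorFourier.norm_fourierIntegral_le_integral_norm _ _ (-innerₗ ℝ) F x

lemma integral_fourierInv_mul {f g : ℝ → ℂ} (hf : Integrable f) (hg : Integrable g) :
    ∫ x, 𝓕⁻ f x * g x = ∫ x, f x * 𝓕⁻ g x := by
  have h := VectorFourier.integral_fourierIntegral_smul_eq_flip (L := -innerₗ ℝ)
    Real.continuous_fourierChar continuous_inner.neg hf hg
  have h1 : (-innerₗ ℝ : ℝ →ₗ[ℝ] ℝ →ₗ[ℝ] ℝ).flip = -innerₗ ℝ := by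
    ext
    simp
  rw [h1] at h
  exact h

/-- For functions in `L¹ ∩ L²` the inverse Fourier transform in `L²` is the integral one. -/
lemma coeFn_fourierInv_toLp {F : ℝ → ℂ} (h1 : Integrable F) (h2 : MemLp F 2 volume) :
    ((𝓕⁻ (h2.toLp F) : L2R) : ℝ → ℂ) =ᵐ[volume] 𝓕⁻ F := by
  refine ae_eq_of_integral_contDiff_smul_eq ((Lp.memLp _).locallyIntegrable (by norm_num))
    (continuous_fourierInv h1).locallyIntegrable fun g g_smooth g_cpt => ?_
  have hg₁ : HasCompactSupport (Complex.ofRealCLM ∘ g) := g_cpt.comp_left rfl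
  have hg₂ := Complex.ofRealCLM.contDiff.comp g_smooth
  set G : 𝓢(ℝ, ℂ) := hg₁.toSchwartzMap hg₂
  have hG (x : ℝ) : G x = (g x : ℂ) := rfl
  -- The $L^2$ transform agrees with the distributional one, which by definition moves onto the test
  -- function; Fubini then moves it back onto $F$.
  have h3 := congrArg (fun T => T G) (Lp.fourierInv_toTemperedDistribution_eq (h2.toLp F))
  simp only [TemperedDistribution.fourierInv_apply, Lp.toTemperedDistribution_apply,
    smul_eq_mul] at h3
  calc ∫ x, g x • (𝓕⁻ (h2.toLp F) : L2R) x = ∫ x, G x * (𝓕⁻ (h2.toLp F) : L2R) x := by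
        simp only [hG, Complex.real_smul]
    _ = ∫ x, (𝓕⁻ G) x * (h2.toLp F) x := h3.symm
    _ = ∫ x, (𝓕⁻ G) x * F x := integral_congr_ae (by
        filter_upwards [h2.coeFn_toLp] with x hx
        rw [hx])
    _ = ∫ x, G x * 𝓕⁻ F x := by
        rw [fourierInv_coe]
        exact integral_fourierInv_mul G.integrable h1
    _ = ∫ x, g x • 𝓕⁻ F x := by simp only [hG, Complex.real_smul]

/-! ### The functions `S_m ξ_n` -/

section Multiplier

variable {m : ℝ → ℝ}

lemma integrable_weighted_fourier (f : 𝓢(ℝ, ℂ)) :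
    Integrable fun v => (1 + (2 * Real.pi * v) ^ 2) * ‖(𝓕 f : 𝓢(ℝ, ℂ)) v‖ ^ 2 := by
  have hi (g : 𝓢(ℝ, ℂ)) : Integrable fun x => ‖g x‖ ^ 2 :=
    (memLp_two_iff_integrable_sq_norm g.continuous.aestronglyMeasurable).1 (g.memLp 2)
  refine ((hi (𝓕 f)).add (hi (𝓕 (derivCLM ℂ ℂ f)))).congr (Eventually.of_forall fun v => ?_)
  simp only [Pi.add_apply, fourier_deriv_apply, norm_mul, Complex.norm_real, Complex.norm_I,
    mul_one, Complex.norm_ofNat, mul_pow, Real.norm_eq_abs, sq_abs]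
  ring

lemma integrable_rescaled (hint : Integrable (fun u : ℝ => m u / (u ^ 2 + 1)) volume) :
    Integrable fun v : ℝ => m (2 * Real.pi * v) / ((2 * Real.pi * v) ^ 2 + 1) :=
  hint.comp_mul_left' (by positivity)

/-- This factorization separates what is known about $m$ from what is known about the transformed
function; the $L^1$ and $L^2$ bounds both start from it. -/
lemma norm_sq_multiplier (hm0 : ∀ u, 0 ≤ m u) (v : ℝ) (z : ℂ) :
    ‖(√(m (2 * Real.pi * v)) : ℂ) * z‖ ^ 2 =
      m (2 * Real.pi * v) / ((2 * Real.pi * v) ^ 2 + 1) *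
        ((1 + (2 * Real.pi * v) ^ 2) * ‖z‖ ^ 2) := by
  rw [norm_mul, mul_pow, Complex.norm_real, Real.norm_eq_abs, sq_abs, Real.sq_sqrt (hm0 _)]
  field_simp
  ring

lemma norm_multiplier_le (hm0 : ∀ u, 0 ≤ m u) (v : ℝ) (z : ℂ) :
    ‖(√(m (2 * Real.pi * v)) : ℂ) * z‖ ≤
      (m (2 * Real.pi * v) / ((2 * Real.pi * v) ^ 2 + 1) +
        (1 + (2 * Real.pi * v) ^ 2) * ‖z‖ ^ 2) / 2 := by
  have h := norm_sq_multiplier hm0 v z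
  set x := m (2 * Real.pi * v) / ((2 * Real.pi * v) ^ 2 + 1)
  set y := (1 + (2 * Real.pi * v) ^ 2) * ‖z‖ ^ 2
  have hx : 0 ≤ x := div_nonneg (hm0 _) (by positivity)
  have hy : 0 ≤ y := by positivity
  refine abs_le_of_sq_le_sq' ?_ (by positivity) |>.2
  rw [h]
  nlinarith [sq_nonneg (x - y)]

lemma aestronglyMeasurable_multiplier (hm : Measurable m) (f : 𝓢(ℝ, ℂ)) :
    AEStronglyMeasurable fun v => (√(m (2 * Real.pi * v)) : ℂ) * f v := by
  have h1 : Measurable fun v : ℝ => ((√(m (2 * Real.pi * v)) : ℝ) : ℂ) := by fun_prop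
  exact h1.aestronglyMeasurable.mul f.continuous.aestronglyMeasurable

lemma integrable_multiplier (hm : Measurable m) (hm0 : ∀ u, 0 ≤ m u)
    (hint : Integrable (fun u : ℝ => m u / (u ^ 2 + 1)) volume) (f : 𝓢(ℝ, ℂ)) :
    Integrable fun v => (√(m (2 * Real.pi * v)) : ℂ) * (𝓕 f : 𝓢(ℝ, ℂ)) v :=
  (((integrable_rescaled hint).add (integrable_weighted_fourier f)).div_const 2).mono'
    (aestronglyMeasurable_multiplier hm _)
    (Eventually.of_forall fun v => norm_multiplier_le hm0 v _)

lemma integral_norm_multiplier_le (hm : Measurable m) (hm0 : ∀ u, 0 ≤ m u)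
    (hint : Integrable (fun u : ℝ => m u / (u ^ 2 + 1)) volume) (f : 𝓢(ℝ, ℂ)) :
    ∫ v, ‖(√(m (2 * Real.pi * v)) : ℂ) * (𝓕 f : 𝓢(ℝ, ℂ)) v‖ ≤
      ((∫ v, m (2 * Real.pi * v) / ((2 * Real.pi * v) ^ 2 + 1)) +
        ((∫ x, ‖f x‖ ^ 2) + ∫ x, ‖deriv f x‖ ^ 2)) / 2 := by
  rw [← integral_one_add_sq_mul_fourier,
    ← integral_add (integrable_rescaled hint) (integrable_weighted_fourier f), ← integral_div]
  exact integral_mono (integrable_multiplier hm hm0 hint f).norm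
    (((integrable_rescaled hint).add (integrable_weighted_fourier f)).div_const 2)
    fun v => norm_multiplier_le hm0 v _

/-- With the second factor bounded and the first integrable, the factorization gives square
integrability. -/
lemma exists_weighted_bound (f : 𝓢(ℝ, ℂ)) :
    ∃ C : ℝ, ∀ v : ℝ, (1 + (2 * Real.pi * v) ^ 2) * ‖f v‖ ^ 2 ≤ C := by
  obtain ⟨C₀, h₀⟩ := f.decay 0 0
  obtain ⟨C₁, h₁⟩ := f.decay 1 0
  refine ⟨C₀ ^ 2 + (2 * Real.pi) ^ 2 * C₁ ^ 2, fun v => ?_⟩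
  have e₀ := h₀.2 v
  have e₁ := h₁.2 v
  simp only [pow_zero, one_mul, pow_one, norm_iteratedFDeriv_zero] at e₀ e₁
  have e₂ : (‖v‖ * ‖f v‖) ^ 2 ≤ C₁ ^ 2 := pow_le_pow_left₀ (by positivity) e₁ 2
  have e₃ : ‖f v‖ ^ 2 ≤ C₀ ^ 2 := pow_le_pow_left₀ (by positivity) e₀ 2
  rw [mul_pow, Real.norm_eq_abs, sq_abs] at e₂
  calc _ = ‖f v‖ ^ 2 + (2 * Real.pi) ^ 2 * (v ^ 2 * ‖f v‖ ^ 2) := by ring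
    _ ≤ _ := by gcongr

lemma memLp_multiplier (hm : Measurable m) (hm0 : ∀ u, 0 ≤ m u)
    (hint : Integrable (fun u : ℝ => m u / (u ^ 2 + 1)) volume) (f : 𝓢(ℝ, ℂ)) :
    MemLp (fun v => (√(m (2 * Real.pi * v)) : ℂ) * f v) 2 volume := by
  rw [memLp_two_iff_integrable_sq_norm (aestronglyMeasurable_multiplier hm f)]
  obtain ⟨C, hC⟩ := exists_weighted_bound f
  refine ((integrable_rescaled hint).mul_const C).mono'
    ((aestronglyMeasurable_multiplier hm f).norm.pow 2) (Eventually.of_forall fun v => ?_)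
  rw [norm_pow, norm_norm, norm_sq_multiplier hm0]
  exact mul_le_mul_of_nonneg_left (hC v) (div_nonneg (hm0 _) (by positivity))

lemma multiplied_hermiteL2 (m : ℝ → ℝ) (k : ℕ) :
    multiplied m (hermiteL2 k) =ᵐ[volume]
      fun v => (√(m (2 * Real.pi * v)) : ℂ) * (𝓕 (hermiteSchwartz k) : 𝓢(ℝ, ℂ)) v := by
  rw [← toLp_hermiteSchwartz]
  unfold multiplied
  rw [toLp_fourier_eq]
  filter_upwards [(𝓕 (hermiteSchwartz k) : 𝓢(ℝ, ℂ)).coeFn_toLp 2] with v hv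
  rw [hv]

/-- The functions `S_m ξ_n` are defined, have continuous representatives, and grow at most linearly
in `n`, uniformly in the variable. -/
lemma exists_continuous_opS_hermite (hm : Measurable m) (hm0 : ∀ u, 0 ≤ m u)
    (hint : Integrable (fun u : ℝ => m u / (u ^ 2 + 1)) volume) :
    ∃ hξ : ∀ k, hermiteL2 k ∈ (opS m).domain, ∃ (s : ℕ → ℝ → ℂ) (C : ℝ),
      (∀ k, Continuous (s k)) ∧ (∀ k x, ‖s k x‖ ≤ C * (k + 1)) ∧
      ∀ k, ((opS m ⟨hermiteL2 k, hξ k⟩ : L2R) : ℝ → ℂ) =ᵐ[volume] s k := by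
  have hξ (k : ℕ) : MemLp (multiplied m (hermiteL2 k)) 2 volume :=
    (memLp_congr_ae (multiplied_hermiteL2 m k)).2 (memLp_multiplier hm hm0 hint _)
  have h1 (k : ℕ) : Integrable (multiplied m (hermiteL2 k)) :=
    (integrable_congr (multiplied_hermiteL2 m k)).2 (integrable_multiplier hm hm0 hint _)
  set M : ℝ := ∫ v, m (2 * Real.pi * v) / ((2 * Real.pi * v) ^ 2 + 1)
  have hM : 0 ≤ M := integral_nonneg fun v => div_nonneg (hm0 _) (by positivity)
  -- The $L^1$ bound is $\frac12(M+1+(2k+1))=\frac M2+k+1\le(\frac M2+1)(k+1)$.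
  refine ⟨hξ, fun k => 𝓕⁻ (multiplied m (hermiteL2 k)), M / 2 + 1,
    fun k => continuous_fourierInv (h1 k), fun k x => ?_,
    fun k => coeFn_fourierInv_toLp (h1 k) (hξ k)⟩
  have h2 : ∫ v, ‖multiplied m (hermiteL2 k) v‖ =
      ∫ v, ‖(√(m (2 * Real.pi * v)) : ℂ) * (𝓕 (hermiteSchwartz k) : 𝓢(ℝ, ℂ)) v‖ :=
    integral_congr_ae ((multiplied_hermiteL2 m k).fun_comp norm)
  have h3 := integral_norm_multiplier_le hm hm0 hint (hermiteSchwartz k)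
  have h4 := integral_sq_deriv_hermiteSchwartz_le k
  rw [integral_sq_hermiteSchwartz, ← h2] at h3
  have h5 := (norm_fourierInv_le (multiplied m (hermiteL2 k)) x).trans h3
  have hk : (0 : ℝ) ≤ k := k.cast_nonneg
  have h6 : (M + (1 + ∫ x, ‖deriv (hermiteSchwartz k) x‖ ^ 2)) / 2 ≤ (M / 2 + 1) * (k + 1) := by
    nlinarith [mul_nonneg hM hk]
  exact h5.trans h6

end Multiplier

end GrassmannProcess

end

noncomputable section

namespace GrassmannProcess

/-! ### Sequences of coefficients of linear growth -/

section LinearGrowth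

variable {φ : ℕ → ℝ} {d : ℕ}

/-- As $c_{\{k\}}^{-2d}$ decreases, $(k+1)c_{\{k\}}^{-2d}$ is at most the sum of the first $k+1$
terms, hence at most $S$. A second factor $c_{\{k\}}^{-2d}$ makes the series converge, whence the
exponent $4d$. -/
lemma summable_succ_mul_weight (hφ : Monotone φ)
    (hd : Summable fun α : Finset ℕ => weight φ α ^ (-2 * (d : ℤ))) :
    Summable fun k : ℕ => ((k : ℝ) + 1) * weight φ {k} ^ (-(4 * (d : ℤ))) := by
  have h1 : Summable fun k : ℕ => weight φ {k} ^ (-2 * (d : ℤ)) :=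
    hd.comp_injective Finset.singleton_injective
  set S := ∑' k : ℕ, weight φ {k} ^ (-2 * (d : ℤ))
  refine Summable.of_nonneg_of_le (fun k => ?_) (fun k => ?_) (h1.mul_left S)
  · exact mul_nonneg (by positivity) (zpow_pos (weight_pos φ _) _).le
  · have hw := weight_pos φ {k}
    have h2 : ((k : ℝ) + 1) * weight φ {k} ^ (-2 * (d : ℤ)) ≤ S := by
      refine le_trans ?_ (h1.sum_le_tsum (Finset.range (k + 1))
        fun j _ => (zpow_pos (weight_pos φ _) _).le)
      have h3 := Finset.card_nsmul_le_sum (Finset.range (k + 1))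
        (fun j => weight φ {j} ^ (-2 * (d : ℤ))) (weight φ {k} ^ (-2 * (d : ℤ))) fun j hj => by
          have hj : j ≤ k := by
            have := Finset.mem_range.1 hj
            omega
          simp only [neg_mul, zpow_neg]
          exact inv_anti₀ (zpow_pos (weight_pos φ _) _)
            (zpow_le_zpow_left₀ (by positivity) (weight_pos φ _).le (weight_singleton_mono hφ hj))
      simpa using h3
    calc ((k : ℝ) + 1) * weight φ {k} ^ (-(4 * (d : ℤ)))
        = ((k : ℝ) + 1) * weight φ {k} ^ (-2 * (d : ℤ)) * weight φ {k} ^ (-2 * (d : ℤ)) := by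
          rw [mul_assoc, ← zpow_add₀ hw.ne']
          congr 2
          ring
      _ ≤ S * weight φ {k} ^ (-2 * (d : ℤ)) :=
          mul_le_mul_of_nonneg_right h2 (zpow_pos hw _).le

lemma coeffSummable_of_linear_growth (hφ : Monotone φ)
    (hd : Summable fun α : Finset ℕ => weight φ α ^ (-2 * (d : ℤ))) {a : ℕ → ℂ} {D : ℝ}
    (ha : ∀ k : ℕ, ‖a k‖ ≤ D * (k + 1)) : CoeffSummable φ (4 * d) a := by
  refine Summable.of_nonneg_of_le (fun k => ?_) (fun k => ?_)
    ((summable_succ_mul_weight hφ hd).mul_left D)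
  · exact mul_nonneg (norm_nonneg _) (zpow_pos (weight_pos φ _) _).le
  · rw [← mul_assoc]
    exact mul_le_mul_of_nonneg_right (ha k) (zpow_pos (weight_pos φ _) _).le

/-- Dominated convergence for series, with majorant $D(k+1)c_{\{k\}}^{-4d}$: convergence of each
coefficient suffices, with no uniformity in $k$ beyond linear growth. -/
lemma tendsto_coeffNorm_sub (hφ : Monotone φ)
    (hd : Summable fun α : Finset ℕ => weight φ α ^ (-2 * (d : ℤ)))
    {ι : Type*} {l : Filter ι} {a : ι → ℕ → ℂ} {b : ℕ → ℂ} {D : ℝ}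
    (hab : ∀ k, Tendsto (fun i => a i k) l (𝓝 (b k)))
    (hD : ∀ᶠ i in l, ∀ k : ℕ, ‖a i k - b k‖ ≤ D * (k + 1)) :
    Tendsto (fun i => coeffNorm φ (4 * d) (a i - b)) l (𝓝 0) := by
  have h := tendsto_tsum_of_dominated_convergence
    (f := fun i k => ‖(a i - b) k‖ * weight φ {k} ^ (-(4 * (d : ℤ)))) (g := fun _ => (0 : ℝ))
    ((summable_succ_mul_weight hφ hd).mul_left D) (fun k => by
      have := (((hab k).sub_const (b k)).norm).mul_const (weight φ {k} ^ (-(4 * (d : ℤ))))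
      simpa using this) (by
      filter_upwards [hD] with i hi k
      have hw := (zpow_pos (weight_pos φ {k}) (-(4 * (d : ℤ)))).le
      rw [norm_mul, norm_norm, Real.norm_of_nonneg hw, ← mul_assoc]
      exact mul_le_mul_of_nonneg_right (hi k) hw)
  simpa [coeffNorm] using h

end LinearGrowth

end GrassmannProcess

end

/-! ### The process and its derivative -/

theorem theorem5p4
    (φ : ℕ → ℝ) (hφ0 : φ 0 = 0) (hφ : Monotone φ)
    (hsum : ∃ d : ℕ, 0 < d ∧ Summable fun α : Finset ℕ => weight φ α ^ (-2 * (d : ℤ)))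
    (m : ℝ → ℝ) (hm : Measurable m) (hm0 : ∀ u, 0 ≤ m u)
    (b K : ℝ) (N : ℕ) (hb : b < 2) (hK : 0 < K)
    (hsmall : ∀ u : ℝ, u ≠ 0 → |u| ≤ 1 → m u ≤ K * |u| ^ (-b))
    (hlarge : ∀ u : ℝ, 1 < |u| → m u ≤ K * |u| ^ (2 * N))
    (hint : Integrable (fun u : ℝ => m u / (u ^ 2 + 1)) volume) :
    ∃ hξ : ∀ k, hermiteL2 k ∈ (opS m).domain,
      (∀ t : ℝ, processSeries m hξ t ∈ distSeries φ) ∧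
      (∀ (t : ℝ) (g : TestSpace φ) (γ : Finset ℕ), Summable fun β =>
        g.series β * conj (grassmannMul (processSeries m hξ t) (basisSeries γ) β)) ∧
      ∃ X W : ℝ → (TestSpace φ →L[ℂ] DistSpace φ),
        (∀ (t : ℝ) (g : TestSpace φ),
          (X t g).series = opT (processSeries m hξ t) g.series) ∧
        (∀ g : TestSpace φ, Continuous fun t : ℝ => X t g) ∧
        (∀ (t : ℝ) (g : TestSpace φ),
          Tendsto (fun h : ℝ => ((h⁻¹ : ℝ) : ℂ) • (X (t + h) g - X t g)) (𝓝[≠] 0) (𝓝 (W t g))) ∧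
        (∀ g : TestSpace φ, Continuous fun t : ℝ => W t g) := by
  obtain ⟨d, -, hd⟩ := hsum
  obtain ⟨hξ, s, C, hs, hC, hae⟩ := exists_continuous_opS_hermite hm hm0 hint
  set A : ℝ → ℕ → ℂ := fun t k => ∫ x in (0 : ℝ)..t, s k x
  have hA (t : ℝ) : processSeries m hξ t = linearSeries (A t) := by
    unfold processSeries
    congr 1
    funext k
    exact intervalIntegral.integral_congr_ae ((hae k).mono fun x hx _ => hx)
  have hsub (t t' : ℝ) (k : ℕ) : ‖A t k - A t' k‖ ≤ C * |t - t'| * (k + 1) := by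
    have h : A t k - A t' k = ∫ x in t'..t, s k x :=
      intervalIntegral.integral_interval_sub_left ((hs k).intervalIntegrable _ _)
        ((hs k).intervalIntegrable _ _)
    rw [h]
    exact (intervalIntegral.norm_integral_le_of_norm_le_const fun x _ => hC k x).trans_eq (by ring)
  have hA0 (t : ℝ) (k : ℕ) : ‖A t k‖ ≤ C * |t| * (k + 1) := by
    have h := hsub t 0 k
    simpa [A] using h
  have hp : (0 : ℤ) ≤ 4 * d := by positivity
  have hAs (t : ℝ) : CoeffSummable φ (4 * d) (A t) :=
    coeffSummable_of_linear_growth hφ hd (hA0 t)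
  have hss (t : ℝ) : CoeffSummable φ (4 * d) fun k => s k t :=
    coeffSummable_of_linear_growth hφ hd fun k => hC k t
  have hder (t : ℝ) (k : ℕ) : HasDerivAt (fun t => A t k) (s k t) t :=
    ((hs k).integral_hasStrictDerivAt 0 t).hasDerivAt
  have hC0 : 0 ≤ C := by simpa using (norm_nonneg _).trans (hC 0 0)
  refine ⟨hξ, fun t => ?_, fun t g γ => ?_,
    fun t => linearOp hφ0 hφ hd hp (A t) (hAs t), fun t => linearOp hφ0 hφ hd hp _ (hss t),
    fun t g => ?_, fun g => ?_, fun t g => ?_, fun g => ?_⟩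
  · rw [hA]
    exact mem_distSeries_of_growth hφ0 hφ hd (norm_linearSeries_le_coeffNorm hφ0 hφ hp (hAs t))
  · rw [hA]
    exact summable_adjoint hφ0 hφ hd hp (hAs t) g γ
  · rw [hA]
    rfl
  · refine continuous_iff_continuousAt.2 fun t => tendsto_linearOp_apply hφ0 hφ hd hp _ _
      (tendsto_coeffNorm_sub (D := C) hφ hd (fun k => (hder t k).continuousAt) ?_) g
    -- Within distance one, the Lipschitz bound $C|t'-t|(k+1)$ is dominated by $C(k+1)$.
    filter_upwards [Metric.ball_mem_nhds t one_pos] with t' ht' k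
    have h1 : |t' - t| ≤ 1 := (Metric.mem_ball.1 ht').le
    refine (hsub t' t k).trans (mul_le_mul_of_nonneg_right ?_ (by positivity))
    exact mul_le_of_le_one_right hC0 h1
  · have hq (h : ℝ) : CoeffSummable φ (4 * d) (((h⁻¹ : ℝ) : ℂ) • (A (t + h) - A t)) :=
      ((hAs _).sub (hAs _)).smul _
    have key := tendsto_linearOp_apply hφ0 hφ hd hp (l := 𝓝[≠] (0 : ℝ)) hq (hss t)
      -- One $C$ bounds the difference quotients, through the Lipschitz estimate, and the other
      -- bounds the limit $s_k(t)$.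
      (tendsto_coeffNorm_sub (D := 2 * C) hφ hd
        (fun k => by
          refine (hasDerivAt_iff_tendsto_slope_zero.1 (hder t k)).congr fun h => ?_
          rw [Complex.real_smul]
          rfl)
        (by
          filter_upwards [self_mem_nhdsWithin] with h hh k
          have hh : h ≠ 0 := hh
          have h1 := hsub (t + h) t k
          rw [add_sub_cancel_left] at h1
          have h2 : ‖(((h⁻¹ : ℝ) : ℂ) • (A (t + h) - A t)) k‖ ≤ C * (k + 1) := by
            rw [Pi.smul_apply, norm_smul, Complex.norm_real, norm_inv, Real.norm_eq_abs,
              inv_mul_le_iff₀ (abs_pos.2 hh)]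
            exact h1.trans_eq (by ring)
          refine (norm_sub_le _ _).trans ((add_le_add h2 (hC k t)).trans_eq (by ring)))) g
    refine key.congr fun h => ?_
    rw [linearOp_sub_apply, real_smul_linearOp_apply]
  · refine continuous_iff_continuousAt.2 fun t => tendsto_linearOp_apply hφ0 hφ hd hp _ _
      -- Continuity of each $s_k$ and the bound uniform in $t$ suffice; equicontinuity in $k$ is not
      -- needed.
      (tendsto_coeffNorm_sub (D := 2 * C) hφ hd (fun k => (hs k).continuousAt)
        (Eventually.of_forall fun t' k => ?_)) g
    exact (norm_sub_le _ _).trans ((add_le_add (hC k t') (hC k t)).trans_eq (by ring))
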